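/- For subspaces $\mathcal X,\mathcal Y\subseteq\mathbb C^n$ and $m=\min(\dim\mathcal X,\dim\mathcal Y)$, the principal angles $\Theta(\mathcal X,\mathcal Y)=[\theta_1,\dots,\theta_m]$, $\theta_k\in[0,\pi/2]$, are defined recursively by $$\cos\theta_k=\max_{x\in\mathcal X}\max_{y\in\mathcal Y}|x^Hy|=|x_k^Hy_k|\quad\text{subject to } \|x\|=\|y\|=1,\ x^Hx_i=0,\ y^Hy_i=0\ (i=1,\dots,k-1),$$ where $(x_k,y_k)$ is any pair attaining the maximum. Write $A^\dagger$ for the Moore–Penrose pseudoinverse of a matrix $A$, $\mathcal R(A)$ for its column range, and $S_+(A)$ for the vector of its positive singular values in nonincreasing order, repeated according to multiplicity. Put $\tan(\pi/2)=\infty$. Let $[X,X_\perp]$ be a unitary matrix with $X\in\mathbb C^{n\times p}$, and let $Y\in\mathbb C^{n\times q}$ either (i) have orthonormal columns, or (ii) satisfy $\operatorname{rank}(Y)=\operatorname{rank}(X^HY)$. Let $\mathcal X=\mathcal R(X)$, $\mathcal Y=\mathcal R(Y)$ and $T=X_\perp^HY(X^HY)^\dagger$. Then the principal angles between $\mathcal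 X$ and $\mathcal Y$ exist, and for any vector of principal angles $\Theta(\mathcal X,\mathcal Y)$ obtained by the recursion, its tangents, arranged in nonincreasing order and repeated according to multiplicity, are $$\tan\Theta(\mathcal X,\mathcal Y)=[\infty,\dots,\infty,\,S_+(T),\,0,\dots,0],$$ with exactly $\min\bigl(\dim(\mathcal X^\perp\cap\mathcal Y),\dim(\mathcal X\cap\mathcal Y^\perp)\bigr)$ entries $\infty$ and exactly $\dim(\mathcal X\cap\mathcal Y)$ zeros; in particular the positive singular values of $T$ are exactly the tangents of the principal angles lying in $(0,\pi/2)$, with multiplicity. In case (ii), $\min\bigl(\dim(\mathcal X^\perp\cap\mathcal Y),\dim(\mathcal X\cap\mathcal Y^\perp)\bigr)=0$. -/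

import Mathlib

open Matrix

/-- The four Penrose equations: `B` is a Moore-Penrose pseudoinverse of `A`. -/
structure IsMoorePenrose {m n : Type*} [Fintype m] [Fintype n]
    (A : Matrix m n ℂ) (B : Matrix n m ℂ) : Prop where
  mul_mul_self : A * B * A = A
  self_mul_mul : B * A * B = B
  left_hermitian : (A * B)ᴴ = A * B
  right_hermitian : (B * A)ᴴ = B * A

/-- The pseudoinverse of `A`, built from the spectral decomposition
`Aᴴ A = U diag(λ) Uᴴ` as `U diag(λ⁻¹) Uᴴ Aᴴ`, with the convention `0⁻¹ = 0`. -/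
noncomputable def pinv {m n : Type*} [Fintype m] [Fintype n] [DecidableEq n]
    (A : Matrix m n ℂ) : Matrix n m ℂ :=
  let h : (Aᴴ * A).IsHermitian := isHermitian_conjTranspose_mul_self A
  (h.eigenvectorUnitary : Matrix n n ℂ) *
    diagonal (fun i => ((h.eigenvalues i)⁻¹ : ℂ)) *
    (h.eigenvectorUnitary : Matrix n n ℂ)ᴴ * Aᴴ

theorem pinv_isMoorePenrose {m n : Type*} [Fintype m] [Fintype n] [DecidableEq n]
    (A : Matrix m n ℂ) : IsMoorePenrose A (pinv A) := by
  have h : (Aᴴ * A).IsHermitian := isHermitian_conjTranspose_mul_self A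
  obtain ⟨U, hU⟩ : ∃ U : Matrix n n ℂ, U = (h.eigenvectorUnitary : Matrix n n ℂ) := ⟨_, rfl⟩
  obtain ⟨d, hd⟩ : ∃ d : n → ℂ, d = fun i => (h.eigenvalues i : ℂ) := ⟨_, rfl⟩
  have hUU : Uᴴ * U = 1 := by
    rw [hU]; exact (Unitary.mem_iff.mp h.eigenvectorUnitary.2).1
  have hG : Aᴴ * A = U * diagonal d * Uᴴ := by
    have := h.spectral_theorem
    rw [Unitary.conjStarAlgAut_apply] at this
    rw [hU, hd]
    exact this
  have hds : ∀ i, star (d i) = d i := by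
    intro i; simp [hd]
  obtain ⟨H, hH⟩ : ∃ H, H = U * diagonal (fun i => (d i)⁻¹) * Uᴴ := ⟨_, rfl⟩
  have hP : pinv A = H * Aᴴ := by
    simp only [pinv, hH, hU, hd]
  have conj_mul : ∀ a b : n → ℂ, (U * diagonal a * Uᴴ) * (U * diagonal b * Uᴴ)
      = U * diagonal (fun i => a i * b i) * Uᴴ := by
    intro a b
    calc (U * diagonal a * Uᴴ) * (U * diagonal b * Uᴴ)
        = U * diagonal a * (Uᴴ * U) * diagonal b * Uᴴ := by simp only [Matrix.mul_assoc]
      _ = _ := by rw [hUU, Matrix.mul_one, Matrix.mul_assoc U, diagonal_mul_diagonal]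
  have hHs : Hᴴ = H := by
    rw [hH, conjTranspose_mul, conjTranspose_mul, conjTranspose_conjTranspose,
      diagonal_conjTranspose, Matrix.mul_assoc]
    congr 3
    funext i
    have := hds i
    simp only [Pi.star_apply, star_inv₀, this]
  have hHG : H * (Aᴴ * A) = U * diagonal (fun i => (d i)⁻¹ * d i) * Uᴴ := by
    rw [hG, hH, conj_mul]
  have hGHG : (Aᴴ * A) * (H * (Aᴴ * A)) = Aᴴ * A := by
    rw [hHG, hG, conj_mul]
    congr 3
    funext i
    by_cases hi : d i = 0 <;> simp [hi]
  have hHGH : H * (Aᴴ * A) * H = H := by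
    rw [hHG, hH, conj_mul]
    congr 3
    funext i
    by_cases hi : d i = 0 <;> simp [hi]
  have key : A * (H * (Aᴴ * A)) = A := by
    have h0 : Aᴴ * A * (H * (Aᴴ * A) - 1) = 0 := by
      rw [Matrix.mul_sub, hGHG, Matrix.mul_one, sub_self]
    have h1 : A * (H * (Aᴴ * A) - 1) = 0 := by
      open scoped ComplexOrder in
      exact (conjTranspose_mul_self_mul_eq_zero A _).mp h0
    rw [Matrix.mul_sub, Matrix.mul_one, sub_eq_zero] at h1
    exact h1
  rw [hP]
  refine ⟨?_, ?_, ?_, ?_⟩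
  · calc A * (H * Aᴴ) * A = A * (H * (Aᴴ * A)) := by simp only [Matrix.mul_assoc]
      _ = A := key
  · calc H * Aᴴ * A * (H * Aᴴ) = (H * (Aᴴ * A) * H) * Aᴴ := by simp only [Matrix.mul_assoc]
      _ = H * Aᴴ := by rw [hHGH]
  · simp only [conjTranspose_mul, conjTranspose_conjTranspose, hHs, Matrix.mul_assoc]
  · rw [Matrix.mul_assoc, hHG, conjTranspose_mul, conjTranspose_mul,
      conjTranspose_conjTranspose, diagonal_conjTranspose, Matrix.mul_assoc]
    congr 3
    funext i
    have := hds i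
    simp only [Pi.star_apply, star_mul', star_inv₀, this]

theorem IsMoorePenrose.unique {m n : Type*} [Fintype m] [Fintype n]
    {A : Matrix m n ℂ} {B C : Matrix n m ℂ} (hB : IsMoorePenrose A B)
    (hC : IsMoorePenrose A C) : B = C := by
  have h1 : A * B = A * C := by
    calc A * B = (A * C) * (A * B) := by
          rw [← Matrix.mul_assoc, hC.mul_mul_self]
      _ = (A * C)ᴴ * (A * B)ᴴ := by rw [hC.left_hermitian, hB.left_hermitian]
      _ = (A * B * A * C)ᴴ := by rw [← conjTranspose_mul]; simp only [Matrix.mul_assoc]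
      _ = A * C := by rw [hB.mul_mul_self, hC.left_hermitian]
  have h2 : B * A = C * A := by
    calc B * A = (B * A) * (C * A) := by
          rw [Matrix.mul_assoc, ← Matrix.mul_assoc A C A, hC.mul_mul_self]
      _ = (B * A)ᴴ * (C * A)ᴴ := by rw [hB.right_hermitian, hC.right_hermitian]
      _ = (C * (A * B * A))ᴴ := by rw [← conjTranspose_mul]; simp only [Matrix.mul_assoc]
      _ = C * A := by rw [hB.mul_mul_self, hC.right_hermitian]
  calc B = B * A * B := hB.self_mul_mul.symm
    _ = C * (A * B) := by rw [h2, Matrix.mul_assoc]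
    _ = C := by rw [h1, ← Matrix.mul_assoc, hC.self_mul_mul]

/-- The column range of a matrix, as a subspace of `ℂⁿ` with its Euclidean inner product. -/
noncomputable def colRange {n k : ℕ} (A : Matrix (Fin n) (Fin k) ℂ) :
    Submodule ℂ (EuclideanSpace ℂ (Fin n)) :=
  LinearMap.range (toEuclideanLin A)

/-- `S₊(A)`: the positive singular values of `A`, in nonincreasing order and repeated
according to multiplicity (`singularValues` lists them in nonincreasing order, and those
with index at least the number of columns vanish). -/
noncomputable def posSingularValues {n k : ℕ} (A : Matrix (Fin n) (Fin k) ℂ) : List ℝ :=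
  ((List.range k).map (fun i => (toEuclideanLin A).singularValues i)).filter
    (fun s => decide (0 < s))

section PrincipalAngles

variable {E : Type*} [NormedAddCommGroup E] [InnerProductSpace ℂ E]

/-- The pairs of unit vectors `u ∈ 𝒳`, `v ∈ 𝒴` that compete at step `k`: `u` is orthogonal to
`x i` and `v` to `y i` for all `i < k`. -/
def admissiblePairs (𝒳 𝒴 : Submodule ℂ E) {m : ℕ} (x y : Fin m → E) (k : Fin m) :
    Set (E × E) :=
  {z | z.1 ∈ 𝒳 ∧ z.2 ∈ 𝒴 ∧ ‖z.1‖ = 1 ∧ ‖z.2‖ = 1 ∧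
    ∀ i < k, inner ℂ z.1 (x i) = 0 ∧ inner ℂ z.2 (y i) = 0}

/-- `θ` is the vector of principal angles between `𝒳` and `𝒴`, by the recursive definition:
`θ k ∈ [0, π/2]`, and `cos (θ k)` is the maximum of `|⟨u, v⟩|` over the admissible pairs at
step `k`, attained at the principal vectors `x k`, `y k`. -/
def IsPrincipalAngles (𝒳 𝒴 : Submodule ℂ E)
    (θ : Fin (min (Module.finrank ℂ 𝒳) (Module.finrank ℂ 𝒴)) → ℝ) : Prop :=
  ∃ x y : Fin (min (Module.finrank ℂ 𝒳) (Module.finrank ℂ 𝒴)) → E,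
    ∀ k, θ k ∈ Set.Icc 0 (Real.pi / 2) ∧
      (x k, y k) ∈ admissiblePairs 𝒳 𝒴 x y k ∧
      Real.cos (θ k) = ‖inner ℂ (x k) (y k)‖ ∧
      ∀ z ∈ admissiblePairs 𝒳 𝒴 x y k, ‖inner ℂ z.1 z.2‖ ≤ Real.cos (θ k)

end PrincipalAngles

/-- The tangent of an angle in `[0, π/2]`, with `tan (π/2) = ∞`. -/
noncomputable def extTan (t : ℝ) : EReal :=
  if t = Real.pi / 2 then ⊤ else ((Real.tan t : ℝ) : EReal)

/-- The vector of tangents of `θ`, listed in reverse order of the index. Principal angles are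
indexed in nondecreasing order, so their tangents are listed in nonincreasing order. -/
noncomputable def tanVector {m : ℕ} (θ : Fin m → ℝ) : List EReal :=
  ((List.ofFn θ).map extTan).reverse

/-! Everything is read off from one diagonal matrix. A maximality argument at each step of the
recursion shows that `x i` is orthogonal to `y j` for `i ≠ j`, and that whatever the recursion
leaves over in either subspace is orthogonal to the principal vectors of the other. So the principal
vectors extend to orthonormal bases `bx`, `by'` of the two subspaces with a diagonal cross Gram
matrix, whose entries `c k` have the cosines as moduli (`IsPrincipalSystem.exists_diagonalBases`).

In these bases `T` is explicit: it kills `X† bx i` if `c i = 0` and otherwise sends it to `(c i)⁻¹ •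
X'† by' i`, where `X'` stands for `X_⊥`. The vectors `X† bx i` form an orthonormal basis of the
domain and their images are pairwise orthogonal, so the singular values are the norms `√(1 - |c|²) /
|c|`, that is, tangents, with `0` where `c i = 0` (`TangentSetting.map_singularValues`). The two
alternatives for `Y` are needed only for `Y G X† Y w = Y w` on suitable `w`
(`TangentSetting.apply_pinv`).

The intersections have dimensions given by counting `c = 0` and `|c| = 1`. Both lists of tangents
are sorted, so it is enough to compare them as multisets (`tanVector_eq`). -/

theorem Multiset.map_fin_univ_eq_map_range {α : Type*} (f : ℕ → α) (n : ℕ) :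
    (Finset.univ : Finset (Fin n)).val.map (fun i : Fin n => f i) = (Multiset.range n).map f := by
  rw [Multiset.range, Multiset.map_coe, ← List.map_coe_finRange_eq_range, List.map_map]
  rfl

/-! ### Singular values from orthogonal images; dimensions from diagonal equations. -/

section SingularValues

open Module

/-- If the images under `T` of the vectors of an orthonormal basis are pairwise orthogonal, then
the singular values of `T` are the norms of these images. -/
theorem LinearMap.map_singularValues_range_finrank {𝕜 E F ι : Type*} [RCLike 𝕜]
    [NormedAddCommGroup E] [InnerProductSpace 𝕜 E] [FiniteDimensional 𝕜 E]
    [NormedAddCommGroup F] [InnerProductSpace 𝕜 F] [FiniteDimensional 𝕜 F]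
    [Fintype ι] [DecidableEq ι] (T : E →ₗ[𝕜] F) (b : OrthonormalBasis ι 𝕜 E)
    (hT : Pairwise fun i j => inner 𝕜 (T (b i)) (T (b j)) = 0) :
    (Multiset.range (finrank 𝕜 E)).map T.singularValues
      = Finset.univ.val.map fun i => ‖T (b i)‖ := by
  have hS := T.isSymmetric_adjoint_comp_self
  have hM : (T.adjoint ∘ₗ T).toMatrix b.toBasis b.toBasis
      = diagonal fun i => (((‖T (b i)‖ ^ 2 : ℝ)) : 𝕜) := by
    ext i j
    rw [LinearMap.toMatrix_apply]
    simp only [OrthonormalBasis.coe_toBasis, OrthonormalBasis.coe_toBasis_repr_apply,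
      OrthonormalBasis.repr_apply_apply, LinearMap.comp_apply, LinearMap.adjoint_inner_right]
    rcases eq_or_ne i j with rfl | hij
    · rw [diagonal_apply_eq, inner_self_eq_norm_sq_to_K]
      push_cast
      rfl
    · rw [diagonal_apply_ne _ hij, hT hij]
  -- Roots of the characteristic polynomial form a multiset, so the eigenvalues are matched with the
  -- squared norms without ordering the basis.
  have h1 : (T.adjoint ∘ₗ T).charpoly.roots
      = Finset.univ.val.map fun i => (((‖T (b i)‖ ^ 2 : ℝ)) : 𝕜) := by
    rw [← LinearMap.charpoly_toMatrix _ b.toBasis, hM, charpoly_diagonal]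
    have := Polynomial.roots_multiset_prod_X_sub_C
      ((Finset.univ : Finset ι).val.map fun i => (((‖T (b i)‖ ^ 2 : ℝ)) : 𝕜))
    rwa [Multiset.map_map] at this
  rw [hS.roots_charpoly_eq_eigenvalues rfl] at h1
  have h2 := congrArg (Multiset.map fun z : 𝕜 => √(RCLike.re z)) h1
  simp only [Multiset.map_map, Function.comp_def, RCLike.ofReal_re, norm_nonneg,
    Real.sqrt_sq] at h2
  rw [← h2]
  simp only [← T.singularValues_fin rfl]
  exact (Multiset.map_fin_univ_eq_map_range T.singularValues _).symm

/-- A subspace cut out by the vanishing of some coordinates. -/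
theorem finrank_eq_card_filter_of_mem_iff {𝕜 V ι : Type*} [Field 𝕜] [AddCommGroup V]
    [Module 𝕜 V] [Fintype ι] [DecidableEq ι] [DecidableEq 𝕜] (b : Basis ι 𝕜 V) (w : ι → 𝕜)
    (S : Submodule 𝕜 V) (hS : ∀ v, v ∈ S ↔ ∀ i, w i * b.repr v i = 0) :
    finrank 𝕜 S = (Finset.univ.filter fun i => w i = 0).card := by
  have hfin : FiniteDimensional 𝕜 V := b.finiteDimensional_of_finite
  have hk : S = LinearMap.ker (toLin' (diagonal w) ∘ₗ b.equivFun.toLinearMap) := by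
    ext v
    rw [hS, LinearMap.mem_ker, funext_iff]
    simp [mulVec_diagonal]
  have h1 := LinearMap.finrank_range_add_finrank_ker
    (toLin' (diagonal w) ∘ₗ b.equivFun.toLinearMap)
  rw [← hk, LinearMap.range_comp_of_range_eq_top _ b.equivFun.range, finrank_eq_card_basis b] at h1
  have h2 : finrank 𝕜 (LinearMap.range (toLin' (diagonal w)))
      = (Finset.univ.filter fun i => w i ≠ 0).card := by
    have := LinearMap.rank_diagonal w
    rw [LinearMap.rank, Fintype.card_subtype] at this
    exact finrank_eq_of_rank_eq this
  have h3 := Finset.card_filter_add_card_filter_not (s := (Finset.univ : Finset ι))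
    (fun i => w i = 0)
  rw [Finset.card_univ] at h3
  simp only [ne_eq] at h2
  omega

end SingularValues

/-! ### Principal vectors and bases with diagonal cross Gram matrix. -/

section Principal

open Module

variable {E : Type*} [NormedAddCommGroup E] [InnerProductSpace ℂ E]

/-- The vectors `x`, `y` are principal vectors, in the order of the recursion, for the first `m`
principal angles `θ`. -/
def IsPrincipalSystem (𝒳 𝒴 : Submodule ℂ E) {m : ℕ} (x y : Fin m → E) (θ : Fin m → ℝ) : Prop :=
  ∀ k, θ k ∈ Set.Icc 0 (Real.pi / 2) ∧
    (x k, y k) ∈ admissiblePairs 𝒳 𝒴 x y k ∧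
    Real.cos (θ k) = ‖inner ℂ (x k) (y k)‖ ∧
    ∀ z ∈ admissiblePairs 𝒳 𝒴 x y k, ‖inner ℂ z.1 z.2‖ ≤ Real.cos (θ k)

theorem mem_admissiblePairs_symm {𝒳 𝒴 : Submodule ℂ E} {m : ℕ} {x y : Fin m → E} {k : Fin m}
    {u v : E} (h : (u, v) ∈ admissiblePairs 𝒳 𝒴 x y k) :
    (v, u) ∈ admissiblePairs 𝒴 𝒳 y x k :=
  ⟨h.2.1, h.1, h.2.2.2.1, h.2.2.1, fun i hi => (h.2.2.2.2 i hi).symm⟩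

namespace IsPrincipalSystem

variable {𝒳 𝒴 : Submodule ℂ E} {m : ℕ} {x y : Fin m → E} {θ : Fin m → ℝ}

theorem symm (h : IsPrincipalSystem 𝒳 𝒴 x y θ) : IsPrincipalSystem 𝒴 𝒳 y x θ := fun k =>
  ⟨(h k).1, mem_admissiblePairs_symm (h k).2.1, by rw [norm_inner_symm]; exact (h k).2.2.1,
    fun z hz => by
      rw [norm_inner_symm]
      exact (h k).2.2.2 (z.2, z.1) (mem_admissiblePairs_symm hz)⟩

theorem orthonormal_left (h : IsPrincipalSystem 𝒳 𝒴 x y θ) : Orthonormal ℂ x := by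
  refine ⟨fun k => (h k).2.1.2.2.1, fun i j hij => ?_⟩
  rcases lt_or_gt_of_ne hij with hlt | hlt
  · rw [inner_eq_zero_symm]
    exact ((h j).2.1.2.2.2.2 i hlt).1
  · exact ((h i).2.1.2.2.2.2 j hlt).1

theorem norm_inner_le (h : IsPrincipalSystem 𝒳 𝒴 x y θ) (k : Fin m) {u : E} (hu : u ∈ 𝒳)
    (hux : ∀ i < k, inner ℂ u (x i) = 0) :
    ‖inner ℂ u (y k)‖ ≤ ‖inner ℂ (x k) (y k)‖ * ‖u‖ := by
  rcases eq_or_ne u 0 with rfl | hu0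
  · simp
  have hn : 0 < ‖u‖ := norm_pos_iff.mpr hu0
  have := (h k).2.2.2 (((‖u‖⁻¹ : ℝ) : ℂ) • u, y k) ⟨𝒳.smul_mem _ hu, (h k).2.1.2.1, by
    simp [norm_smul, hn.ne'], (h k).2.1.2.2.2.1, fun i hi =>
      ⟨by simp only; rw [inner_smul_left, hux i hi, mul_zero], ((h k).2.1.2.2.2.2 i hi).2⟩⟩
  rw [(h k).2.2.1, inner_smul_left, norm_mul, RCLike.norm_conj, Complex.norm_real, norm_inv,
    norm_norm, inv_mul_le_iff₀ hn] at this
  linarith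

/-- If `u` had a component along `y k`, tilting `x k` towards `u` would increase the maximum. The
best tilt is `w = α • x k + β • u`, for which `⟨w, y k⟩ = ‖w‖²`; maximality gives `‖w‖ ≤ |α|`, while
`‖w‖² = |α|² + |β|²`, so `β = 0`. -/
theorem inner_eq_zero_of_norm_one (h : IsPrincipalSystem 𝒳 𝒴 x y θ) (k : Fin m) {u : E}
    (hu : u ∈ 𝒳) (hux : ∀ i ≤ k, inner ℂ u (x i) = 0) (hu1 : ‖u‖ = 1) :
    inner ℂ u (y k) = 0 := by
  set α := inner ℂ (x k) (y k) with hα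
  set β := inner ℂ u (y k) with hβ
  have hx1 : ‖x k‖ = 1 := (h k).2.1.2.2.1
  have hxu : inner ℂ (x k) u = 0 := inner_eq_zero_symm.mp (hux k le_rfl)
  set w := α • x k + β • u with hw
  have hwn : ‖w‖ * ‖w‖ = ‖α‖ * ‖α‖ + ‖β‖ * ‖β‖ := by
    rw [hw, norm_add_sq_eq_norm_sq_add_norm_sq_of_inner_eq_zero (𝕜 := ℂ), norm_smul, norm_smul, hx1,
      hu1, mul_one, mul_one]
    rw [inner_smul_left, inner_smul_right, hxu, mul_zero, mul_zero]
  have hwi : inner ℂ w (y k) = ((‖w‖ * ‖w‖ : ℝ) : ℂ) := by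
    rw [hwn, hw, inner_add_left, inner_smul_left, inner_smul_left, ← hα, ← hβ,
      RCLike.conj_mul, RCLike.conj_mul]
    push_cast
    simp only [Complex.coe_algebraMap]
    ring
  have hle := h.norm_inner_le k (u := w)
    (𝒳.add_mem (𝒳.smul_mem _ (h k).2.1.1) (𝒳.smul_mem _ hu)) (fun i hi => by
      rw [hw, inner_add_left, inner_smul_left, inner_smul_left, hux i hi.le,
        ((h k).2.1.2.2.2.2 i hi).1, mul_zero, mul_zero, add_zero])
  rw [hwi, Complex.norm_real, Real.norm_of_nonneg (by positivity), ← hα] at hle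
  rw [← norm_eq_zero]
  have h1 : ‖w‖ ≤ ‖α‖ := by
    by_contra hc
    push Not at hc
    nlinarith [norm_nonneg α]
  nlinarith [norm_nonneg w, norm_nonneg β]

theorem inner_eq_zero (h : IsPrincipalSystem 𝒳 𝒴 x y θ) (k : Fin m) {u : E}
    (hu : u ∈ 𝒳) (hux : ∀ i ≤ k, inner ℂ u (x i) = 0) : inner ℂ u (y k) = 0 := by
  rcases eq_or_ne u 0 with rfl | hu0
  · simp
  have hn : ‖u‖ ≠ 0 := norm_ne_zero_iff.mpr hu0
  have := h.inner_eq_zero_of_norm_one k (u := ((‖u‖⁻¹ : ℝ) : ℂ) • u) (𝒳.smul_mem _ hu)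
    (fun i hi => by rw [inner_smul_left, hux i hi, mul_zero]) (by simp [norm_smul, hn])
  rw [inner_smul_left] at this
  simpa [hn, hu0] using this

theorem inner_ne_eq_zero (h : IsPrincipalSystem 𝒳 𝒴 x y θ) {i j : Fin m} (hij : i ≠ j) :
    inner ℂ (x i) (y j) = 0 := by
  rcases lt_or_gt_of_ne hij with hlt | hlt
  · rw [inner_eq_zero_symm]
    exact h.symm.inner_eq_zero i (h j).2.1.2.1 fun l hl =>
      ((h j).2.1.2.2.2.2 l (hl.trans_lt hlt)).2
  · exact h.inner_eq_zero j (h i).2.1.1 fun l hl => ((h i).2.1.2.2.2.2 l (hl.trans_lt hlt)).1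

/-- The admissible sets shrink along the recursion, so the maxima cannot grow. -/
theorem monotone (h : IsPrincipalSystem 𝒳 𝒴 x y θ) : Monotone θ := by
  intro i j hij
  have h1 : Real.cos (θ j) ≤ Real.cos (θ i) := by
    rw [(h j).2.2.1]
    exact (h i).2.2.2 (x j, y j) ⟨(h j).2.1.1, (h j).2.1.2.1, (h j).2.1.2.2.1,
      (h j).2.1.2.2.2.1, fun l hl => (h j).2.1.2.2.2.2 l (hl.trans_le hij)⟩
  have hI : ∀ k, θ k ∈ Set.Icc 0 Real.pi := fun k =>
    ⟨(h k).1.1, (h k).1.2.trans (by linarith [Real.pi_pos])⟩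
  exact (Real.strictAntiOn_cos.le_iff_ge (hI j) (hI i)).mp h1

end IsPrincipalSystem

/-- An orthonormal family in a subspace, indexed by an initial segment, extends to an orthonormal
basis of the subspace. -/
theorem Orthonormal.exists_extension_fin {𝒳 : Submodule ℂ E} [FiniteDimensional ℂ 𝒳] {m : ℕ}
    {x : Fin m → E} (hx : Orthonormal ℂ x) (hmem : ∀ k, x k ∈ 𝒳) (hm : m ≤ finrank ℂ 𝒳) :
    ∃ b : OrthonormalBasis (Fin (finrank ℂ 𝒳)) ℂ 𝒳,
      ∀ k : Fin m, (b (Fin.castLE hm k) : E) = x k := by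
  let v : Fin (finrank ℂ 𝒳) → 𝒳 := fun i => if h : i.1 < m then ⟨x ⟨i, h⟩, hmem _⟩ else 0
  have hv : Orthonormal ℂ (({i | i.1 < m} : Set (Fin (finrank ℂ 𝒳))).domRestrict v) := by
    have h1 : Orthonormal ℂ (fun i : ({i | i.1 < m} : Set (Fin (finrank ℂ 𝒳))) =>
        x ⟨i.1.1, i.2⟩) := hx.comp _ fun i j hij => by
      ext
      simpa using hij
    refine ⟨fun i => ?_, fun i j hij => ?_⟩
    · have := h1.1 i
      have hi : i.1.1 < m := i.2
      simpa [v, hi] using this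
    · have := h1.2 hij
      have hi : i.1.1 < m := i.2
      have hj : j.1.1 < m := j.2
      simpa [v, hi, hj] using this
  obtain ⟨b, hb⟩ := hv.exists_orthonormalBasis_extension_of_card_eq (by simp)
  exact ⟨b, fun k => by
    rw [hb _ (by simp)]
    simp [v]⟩

/-- Orthonormal bases of two subspaces whose cross Gram matrix is diagonal. -/
structure DiagonalBases (𝒳 𝒴 : Submodule ℂ E) (bx : OrthonormalBasis (Fin (finrank ℂ 𝒳)) ℂ 𝒳)
    (by' : OrthonormalBasis (Fin (finrank ℂ 𝒴)) ℂ 𝒴) (c : ℕ → ℂ) : Prop where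
  inner_eq : ∀ i j, inner ℂ (bx i : E) (by' j : E) = if i.1 = j.1 then c i else 0
  eq_zero : ∀ i, min (finrank ℂ 𝒳) (finrank ℂ 𝒴) ≤ i → c i = 0

theorem IsPrincipalSystem.exists_diagonalBases {𝒳 𝒴 : Submodule ℂ E}
    [FiniteDimensional ℂ 𝒳] [FiniteDimensional ℂ 𝒴]
    {x y : Fin (min (finrank ℂ 𝒳) (finrank ℂ 𝒴)) → E}
    {θ : Fin (min (finrank ℂ 𝒳) (finrank ℂ 𝒴)) → ℝ} (h : IsPrincipalSystem 𝒳 𝒴 x y θ) :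
    ∃ bx by' c, DiagonalBases 𝒳 𝒴 bx by' c ∧ ∀ k, Real.cos (θ k) = ‖c k‖ := by
  obtain ⟨bx, hbx⟩ := h.orthonormal_left.exists_extension_fin (fun k => (h k).2.1.1)
    (min_le_left _ _)
  obtain ⟨b, hb⟩ := h.symm.orthonormal_left.exists_extension_fin (fun k => (h k).2.1.2.1)
    (min_le_right _ _)
  have hbx' : ∀ (i : Fin (finrank ℂ 𝒳)) (hi : i.1 < min (finrank ℂ 𝒳) (finrank ℂ 𝒴)),
      (bx i : E) = x ⟨i, hi⟩ := fun i hi => hbx ⟨i, hi⟩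
  have hb' : ∀ (i : Fin (finrank ℂ 𝒴)) (hi : i.1 < min (finrank ℂ 𝒳) (finrank ℂ 𝒴)),
      (b i : E) = y ⟨i, hi⟩ := fun i hi => hb ⟨i, hi⟩
  refine ⟨bx, b, fun i => if hi : i < min (finrank ℂ 𝒳) (finrank ℂ 𝒴) then
    inner ℂ (x ⟨i, hi⟩) (y ⟨i, hi⟩) else 0, ⟨fun i j => ?_, fun i hi => ?_⟩, fun k => ?_⟩
  · have hox : ∀ i k, bx i ≠ bx k → inner ℂ (bx i : E) (bx k : E) = 0 := fun i k hik =>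
      bx.orthonormal.2 (fun e => hik (by rw [e]))
    by_cases hi : i.1 < min (finrank ℂ 𝒳) (finrank ℂ 𝒴) <;>
    by_cases hj : j.1 < min (finrank ℂ 𝒳) (finrank ℂ 𝒴)
    · rw [hbx' i hi, hb' j hj]
      by_cases hij : i.1 = j.1
      · simp only [hij, hj, if_true, dif_pos]
      · rw [if_neg hij]
        exact h.inner_ne_eq_zero (by simpa using hij)
    · rw [if_neg (by omega), hbx' i hi, inner_eq_zero_symm]
      refine h.symm.inner_eq_zero _ (b j).2 fun l _ => ?_
      rw [← hb l]
      exact b.orthonormal.2 fun e => hj (by rw [e]; exact l.2)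
    · rw [if_neg (by omega), hb' j hj]
      refine h.inner_eq_zero _ (bx i).2 fun l _ => ?_
      rw [← hbx l]
      exact bx.orthonormal.2 fun e => hi (by rw [e]; exact l.2)
    -- Both indices cannot reach the minimum of the two dimensions: the principal vectors already
    -- exhaust the smaller subspace.
    · have := i.2
      have := j.2
      omega
  · simp only [not_lt.mpr hi, dif_neg, not_false_iff]
  · simp only [k.2, dif_pos, (h k).2.2.1]

end Principal

/-! ### Existence of principal vectors, and dimensions of intersections. -/

section Principal

open Module

variable {E : Type*} [NormedAddCommGroup E] [InnerProductSpace ℂ E]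

/-- Fewer linear conditions than dimensions leave a nonzero solution, which is then normalised. -/
theorem Submodule.exists_norm_eq_one_inner_eq_zero (𝒳 : Submodule ℂ E) [FiniteDimensional ℂ 𝒳]
    {K : ℕ} (hK : K < finrank ℂ 𝒳) (v : Fin K → E) :
    ∃ u ∈ 𝒳, ‖u‖ = 1 ∧ ∀ i, inner ℂ u (v i) = 0 := by
  let f : 𝒳 →ₗ[ℂ] Fin K → ℂ := LinearMap.pi fun i => (innerₛₗ ℂ (v i)) ∘ₗ 𝒳.subtype
  obtain ⟨u, hu, hu0⟩ := (LinearMap.ker f).ne_bot_iff.mp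
    (LinearMap.ker_ne_bot_of_finrank_lt (f := f) (by simpa using hK))
  have hn : ‖(u : E)‖ ≠ 0 := by simpa using hu0
  refine ⟨((‖(u : E)‖⁻¹ : ℝ) : ℂ) • (u : E), 𝒳.smul_mem _ u.2, by
    rw [norm_smul, Complex.norm_real, norm_inv, norm_norm, inv_mul_cancel₀ hn], fun i => ?_⟩
  have h1 : inner ℂ (v i) (u : E) = 0 := congrFun (LinearMap.mem_ker.mp hu) i
  rw [inner_smul_left, inner_eq_zero_symm.mp h1, mul_zero]

theorem isCompact_admissiblePairs [FiniteDimensional ℂ E] (𝒳 𝒴 : Submodule ℂ E) {m : ℕ}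
    (x y : Fin m → E) (k : Fin m) : IsCompact (admissiblePairs 𝒳 𝒴 x y k) := by
  have : ProperSpace E := FiniteDimensional.proper ℂ E
  have hX : IsClosed (𝒳 : Set E) := 𝒳.closed_of_finiteDimensional
  have hY : IsClosed (𝒴 : Set E) := 𝒴.closed_of_finiteDimensional
  refine Metric.isCompact_of_isClosed_isBounded ?_ ?_
  · refine (hX.preimage continuous_fst).inter ((hY.preimage continuous_snd).inter
      ((isClosed_eq (by fun_prop) (by fun_prop)).inter
        ((isClosed_eq (by fun_prop) (by fun_prop)).inter ?_)))
    have : {z : E × E | ∀ i < k, inner ℂ z.1 (x i) = 0 ∧ inner ℂ z.2 (y i) = 0}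
        = ⋂ i, ⋂ (_ : i < k), {z | inner ℂ z.1 (x i) = 0 ∧ inner ℂ z.2 (y i) = 0} := by
      ext; simp
    change IsClosed {z : E × E | ∀ i < k, inner ℂ z.1 (x i) = 0 ∧ inner ℂ z.2 (y i) = 0}
    rw [this]
    exact isClosed_iInter fun i => isClosed_iInter fun _ =>
      (isClosed_eq (by fun_prop) (by fun_prop)).inter (isClosed_eq (by fun_prop) (by fun_prop))
  · refine (Metric.isBounded_closedBall (x := (0 : E × E)) (r := 1)).subset fun z hz => ?_
    rw [mem_closedBall_zero_iff, Prod.norm_def, hz.2.2.1, hz.2.2.2.1, max_self]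

theorem admissiblePairs_nonempty {𝒳 𝒴 : Submodule ℂ E} [FiniteDimensional ℂ 𝒳]
    [FiniteDimensional ℂ 𝒴] {m : ℕ} (hX : m ≤ finrank ℂ 𝒳) (hY : m ≤ finrank ℂ 𝒴)
    (x y : Fin m → E) (k : Fin m) : (admissiblePairs 𝒳 𝒴 x y k).Nonempty := by
  obtain ⟨u, hu, hu1, hux⟩ := 𝒳.exists_norm_eq_one_inner_eq_zero (k.2.trans_le hX)
    fun i : Fin k => x ⟨i, i.2.trans k.2⟩
  obtain ⟨v, hv, hv1, hvy⟩ := 𝒴.exists_norm_eq_one_inner_eq_zero (k.2.trans_le hY)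
    fun i : Fin k => y ⟨i, i.2.trans k.2⟩
  exact ⟨(u, v), hu, hv, hu1, hv1, fun i hi => ⟨hux ⟨i, hi⟩, hvy ⟨i, hi⟩⟩⟩

theorem admissiblePairs_congr {𝒳 𝒴 : Submodule ℂ E} {m : ℕ} {x y x' y' : Fin m → E} {k : Fin m}
    (hx : ∀ i < k, x i = x' i) (hy : ∀ i < k, y i = y' i) :
    admissiblePairs 𝒳 𝒴 x y k = admissiblePairs 𝒳 𝒴 x' y' k := by
  ext z
  refine and_congr_right fun _ => and_congr_right fun _ => and_congr_right fun _ =>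
    and_congr_right fun _ => forall₂_congr fun i hi => ?_
  rw [hx i hi, hy i hi]

/-- Each step maximises a continuous function on a nonempty compact set. Competition at step `k`
involves only vectors of smaller index, so overwriting entry `K` leaves the earlier steps intact. -/
theorem exists_isPrincipalSystem [FiniteDimensional ℂ E] {𝒳 𝒴 : Submodule ℂ E} {m : ℕ}
    (hX : m ≤ finrank ℂ 𝒳) (hY : m ≤ finrank ℂ 𝒴) :
    ∃ (x y : Fin m → E) (θ : Fin m → ℝ), IsPrincipalSystem 𝒳 𝒴 x y θ := by
  have step : ∀ K ≤ m, ∃ x y : Fin m → E, ∀ k : Fin m, k.1 < K →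
      (x k, y k) ∈ admissiblePairs 𝒳 𝒴 x y k ∧
      ∀ z ∈ admissiblePairs 𝒳 𝒴 x y k, ‖inner ℂ z.1 z.2‖ ≤ ‖inner ℂ (x k) (y k)‖ := by
    intro K
    induction K with
    | zero => exact fun _ => ⟨0, 0, fun k hk => absurd hk (Nat.not_lt_zero _)⟩
    | succ K ih =>
      intro hK
      obtain ⟨x, y, hxy⟩ := ih (Nat.le_of_succ_le hK)
      obtain ⟨z, hz, hmax⟩ := (isCompact_admissiblePairs 𝒳 𝒴 x y ⟨K, hK⟩).exists_isMaxOn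
        (admissiblePairs_nonempty hX hY x y ⟨K, hK⟩)
        (f := fun z => ‖inner ℂ z.1 z.2‖) (by fun_prop)
      refine ⟨Function.update x ⟨K, hK⟩ z.1, Function.update y ⟨K, hK⟩ z.2, fun k hk => ?_⟩
      have hlt : ∀ i < k, i ≠ ⟨K, hK⟩ := fun i hi e => by
        have h1 : i.1 < k.1 := hi
        have h2 : i.1 = K := congrArg Fin.val e
        omega
      rw [admissiblePairs_congr (x' := x) (y' := y)
        (fun i hi => Function.update_of_ne (hlt i hi) _ _)
        (fun i hi => Function.update_of_ne (hlt i hi) _ _)]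
      rcases eq_or_ne k ⟨K, hK⟩ with rfl | hne
      · simp only [Function.update_self]
        exact ⟨hz, fun w hw => hmax hw⟩
      · rw [Function.update_of_ne hne, Function.update_of_ne hne]
        refine hxy k ?_
        have : k.1 ≠ K := fun e => hne (Fin.ext e)
        omega
  obtain ⟨x, y, hxy⟩ := step m le_rfl
  refine ⟨x, y, fun k => Real.arccos ‖inner ℂ (x k) (y k)‖, fun k => ?_⟩
  obtain ⟨hk, hmax⟩ := hxy k k.2
  have hc : Real.cos (Real.arccos ‖inner ℂ (x k) (y k)‖) = ‖inner ℂ (x k) (y k)‖ := by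
    refine Real.cos_arccos (by linarith [norm_nonneg (inner ℂ (x k) (y k))]) ?_
    have := norm_inner_le_norm (𝕜 := ℂ) (x k) (y k)
    rwa [hk.2.2.1, hk.2.2.2.1, mul_one] at this
  exact ⟨⟨Real.arccos_nonneg _, Real.arccos_le_pi_div_two.mpr (norm_nonneg _)⟩, hk, hc,
    fun z hz => hc.symm ▸ hmax z hz⟩

theorem OrthonormalBasis.mem_orthogonal_iff {ι : Type*} [Fintype ι] {𝒳 : Submodule ℂ E}
    (b : OrthonormalBasis ι ℂ 𝒳) {v : E} : v ∈ 𝒳ᗮ ↔ ∀ i, inner ℂ (b i : E) v = 0 := by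
  refine ⟨fun h i => h _ (b i).2, fun h u hu => ?_⟩
  have hs := congrArg (Subtype.val) (b.sum_repr ⟨u, hu⟩)
  rw [← show _ = u from hs, Submodule.coe_sum, sum_inner]
  exact Finset.sum_eq_zero fun i _ => by
    rw [Submodule.coe_smul, inner_smul_left, h i, mul_zero]

namespace DiagonalBases

variable {𝒳 𝒴 : Submodule ℂ E} {bx : OrthonormalBasis (Fin (finrank ℂ 𝒳)) ℂ 𝒳}
  {by' : OrthonormalBasis (Fin (finrank ℂ 𝒴)) ℂ 𝒴} {c : ℕ → ℂ}

theorem symm (D : DiagonalBases 𝒳 𝒴 bx by' c) :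
    DiagonalBases 𝒴 𝒳 by' bx (fun i => star (c i)) where
  inner_eq i j := by
    rw [← inner_conj_symm, D.inner_eq]
    by_cases h : i.1 = j.1
    · simp [h]
    · simp [h, Ne.symm h]
  eq_zero i hi := by
    rw [min_comm] at hi
    simp [D.eq_zero i hi]

theorem lt_of_ne_zero (D : DiagonalBases 𝒳 𝒴 bx by' c) {i : ℕ} (h : c i ≠ 0) :
    i < finrank ℂ 𝒳 ∧ i < finrank ℂ 𝒴 := by
  by_contra hc
  exact h (D.eq_zero i (by omega))

theorem sub_smul_mem_orthogonal (D : DiagonalBases 𝒳 𝒴 bx by' c) {i : Fin (finrank ℂ 𝒳)}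
    {j : Fin (finrank ℂ 𝒴)} (h : i.1 = j.1) : (by' j : E) - c j • (bx i : E) ∈ 𝒳ᗮ := by
  rw [bx.mem_orthogonal_iff]
  intro l
  have h1 : inner ℂ (bx l : E) (bx i : E) = if l = i then 1 else 0 :=
    orthonormal_iff_ite.mp bx.orthonormal l i
  rw [inner_sub_right, inner_smul_right, D.inner_eq, h1]
  by_cases hl : l = i
  · simp [hl, h]
  · have : l.1 ≠ j.1 := fun e => hl (Fin.ext (e.trans h.symm))
    simp [hl, this]

theorem mem_orthogonal_of_eq_zero (D : DiagonalBases 𝒳 𝒴 bx by' c) {j : Fin (finrank ℂ 𝒴)}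
    (h : c j = 0) : (by' j : E) ∈ 𝒳ᗮ := by
  rw [bx.mem_orthogonal_iff]
  intro l
  rw [D.inner_eq]
  split_ifs with e
  · rw [e, h]
  · rfl

/-- Projecting `bx i` onto `𝒴` gives a multiple of `by' j`, and only this projection is seen by
vectors of `𝒴`. -/
theorem inner_left (D : DiagonalBases 𝒳 𝒴 bx by' c) {i : Fin (finrank ℂ 𝒳)}
    {j : Fin (finrank ℂ 𝒴)} (h : i.1 = j.1) {v : E} (hv : v ∈ 𝒴) :
    inner ℂ (bx i : E) v = c j * inner ℂ (by' j : E) v := by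
  have h1 := D.symm.sub_smul_mem_orthogonal h.symm v hv
  rw [inner_eq_zero_symm, inner_sub_left, sub_eq_zero, inner_smul_left] at h1
  rw [h1, h]
  simp

theorem finrank_orthogonal_inf (D : DiagonalBases 𝒳 𝒴 bx by' c) :
    finrank ℂ ↥(𝒳ᗮ ⊓ 𝒴)
      = (Finset.univ.filter fun j : Fin (finrank ℂ 𝒴) => c j = 0).card := by
  rw [inf_comm, ← Submodule.map_comap_subtype, Submodule.finrank_map_subtype_eq]
  refine finrank_eq_card_filter_of_mem_iff by'.toBasis (fun j => c j) _ fun v => ?_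
  simp only [OrthonormalBasis.coe_toBasis_repr_apply, OrthonormalBasis.repr_apply_apply,
    Submodule.coe_inner]
  rw [Submodule.mem_comap, bx.mem_orthogonal_iff]
  refine ⟨fun h j => ?_, fun h i => ?_⟩
  · rcases eq_or_ne (c j) 0 with h0 | h0
    · rw [h0, zero_mul]
    · rw [← D.inner_left (i := ⟨j, (D.lt_of_ne_zero h0).1⟩) rfl v.2]
      exact h _
  · rcases eq_or_ne (c i) 0 with h0 | h0
    · exact inner_eq_zero_symm.mp
        (D.symm.mem_orthogonal_of_eq_zero (by simp [h0]) _ v.2)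
    · exact (D.inner_left (j := ⟨i, (D.lt_of_ne_zero h0).2⟩) rfl v.2).trans (h _)

theorem coe_eq_smul (D : DiagonalBases 𝒳 𝒴 bx by' c) {i : Fin (finrank ℂ 𝒳)}
    {j : Fin (finrank ℂ 𝒴)} (h : i.1 = j.1) (hc : ‖c j‖ = 1) :
    (by' j : E) = c j • (bx i : E) := by
  have hx : ‖(bx i : E)‖ = 1 := bx.orthonormal.1 i
  have hy : ‖(by' j : E)‖ = 1 := by'.orthonormal.1 j
  symm
  rw [← inner_eq_one_iff_of_norm_eq_one (𝕜 := ℂ) (by rw [norm_smul, hc, hx, mul_one]) hy,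
    inner_smul_left, D.inner_eq, if_pos h, h, RCLike.conj_mul, hc]
  simp

theorem finrank_inf (D : DiagonalBases 𝒳 𝒴 bx by' c) :
    finrank ℂ ↥(𝒳 ⊓ 𝒴)
      = (Finset.univ.filter fun j : Fin (finrank ℂ 𝒴) => ‖c j‖ = 1).card := by
  rw [inf_comm, ← Submodule.map_comap_subtype, Submodule.finrank_map_subtype_eq]
  have hw : ∀ i, (1 - star (c i) * c i = 0 ↔ ‖c i‖ = 1) := fun i => by
    have : star (c i) * c i = ((‖c i‖ ^ 2 : ℝ) : ℂ) := by
      simpa using RCLike.conj_mul (c i)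
    rw [this, sub_eq_zero, eq_comm]
    norm_cast
    exact pow_eq_one_iff_of_nonneg (norm_nonneg _) two_ne_zero
  simp only [← hw]
  -- For `v` in both subspaces, passing from `by' j` to `bx j` and back multiplies the coordinate by
  -- `|c j|²`, so it vanishes unless `|c j| = 1`. Conversely, when `|c j| = 1` the vector `by' j` is
  -- a multiple of `bx j` and lies in `𝒳`.
  refine finrank_eq_card_filter_of_mem_iff by'.toBasis (fun j => 1 - star (c j) * c j) _
    fun v => ?_
  simp only [OrthonormalBasis.coe_toBasis_repr_apply, OrthonormalBasis.repr_apply_apply,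
    Submodule.coe_inner]
  rw [Submodule.mem_comap, Submodule.subtype_apply]
  refine ⟨fun h j => ?_, fun h => ?_⟩
  · rcases eq_or_ne (c j) 0 with h0 | h0
    · rw [inner_eq_zero_symm.mp (D.mem_orthogonal_of_eq_zero h0 _ h), mul_zero]
    · have h1 := D.inner_left (i := ⟨j, (D.lt_of_ne_zero h0).1⟩) rfl v.2
      have h2 := D.symm.inner_left (j := ⟨j, (D.lt_of_ne_zero h0).1⟩) (i := j) rfl h
      rw [sub_mul, one_mul, sub_eq_zero, mul_assoc, ← h1, ← h2]
  · have hs : (v : E) = ∑ j, inner ℂ (by' j : E) (v : E) • (by' j : E) := by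
      have := congrArg Subtype.val (by'.sum_repr' v)
      rw [Submodule.coe_sum] at this
      exact this.symm
    rw [hs]
    refine 𝒳.sum_mem fun j _ => ?_
    rcases mul_eq_zero.mp (h j) with h1 | h1
    · rw [hw] at h1
      have h0 : c j ≠ 0 := fun e => by simp [e] at h1
      rw [D.coe_eq_smul (i := ⟨j, (D.lt_of_ne_zero h0).1⟩) rfl h1]
      exact 𝒳.smul_mem _ (𝒳.smul_mem _ (bx _).2)
    · rw [h1, zero_smul]
      exact 𝒳.zero_mem

end DiagonalBases

end Principal

/-! ### The tangent map in the diagonal bases. -/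

section TangentMap

open Module

variable {E P Q R : Type*}
  [NormedAddCommGroup E] [InnerProductSpace ℂ E] [FiniteDimensional ℂ E]
  [NormedAddCommGroup P] [InnerProductSpace ℂ P] [FiniteDimensional ℂ P]
  [NormedAddCommGroup Q] [InnerProductSpace ℂ Q]
  [NormedAddCommGroup R] [InnerProductSpace ℂ R] [FiniteDimensional ℂ R]

/-- The setting in which `X'† Y (X† Y)†` is formed, with linear maps in place of matrices: `X` and
`X'` are isometries with complementary ranges, `G` is the pseudoinverse of `X† Y`, and `Y` is an
isometry or `X†` is injective on its range. -/
structure TangentSetting (X : P →ₗ[ℂ] E) (X' : R →ₗ[ℂ] E) (Y : Q →ₗ[ℂ] E) (G : P →ₗ[ℂ] Q) :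
    Prop where
  adjoint_apply_apply : ∀ z, X.adjoint (X z) = z
  add_eq : ∀ v, X (X.adjoint v) + X' (X'.adjoint v) = v
  mul_mul_self : ∀ w, X.adjoint (Y (G (X.adjoint (Y w)))) = X.adjoint (Y w)
  self_mul_mul : ∀ z, G (X.adjoint (Y (G z))) = G z
  left_symmetric : ∀ z z', inner ℂ (X.adjoint (Y (G z))) z' = inner ℂ z (X.adjoint (Y (G z')))
  right_symmetric : ∀ w w', inner ℂ (G (X.adjoint (Y w))) w' = inner ℂ w (G (X.adjoint (Y w')))
  isometry_or_injOn : (∀ w w', inner ℂ (Y w) (Y w') = inner ℂ w w') ∨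
    ∀ w, X.adjoint (Y w) = 0 → Y w = 0

theorem LinearMap.adjoint_eq_zero_of_mem_range_orthogonal (X : P →ₗ[ℂ] E) {v : E}
    (hv : v ∈ (LinearMap.range X)ᗮ) : X.adjoint v = 0 := by
  rw [← inner_self_eq_zero (𝕜 := ℂ), LinearMap.adjoint_inner_right]
  exact hv _ (LinearMap.mem_range_self _ _)

theorem DiagonalBases.adjoint_eq_smul {X : P →ₗ[ℂ] E} {𝒴 : Submodule ℂ E}
    {bx : OrthonormalBasis (Fin (finrank ℂ (LinearMap.range X))) ℂ (LinearMap.range X)}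
    {by' : OrthonormalBasis (Fin (finrank ℂ 𝒴)) ℂ 𝒴} {c : ℕ → ℂ}
    (D : DiagonalBases (LinearMap.range X) 𝒴 bx by' c)
    {i : Fin (finrank ℂ (LinearMap.range X))} {j : Fin (finrank ℂ 𝒴)}
    (h : i.1 = j.1) : X.adjoint (by' j) = c i • X.adjoint (bx i) := by
  have := X.adjoint_eq_zero_of_mem_range_orthogonal (D.sub_smul_mem_orthogonal h)
  rwa [map_sub, map_smul, sub_eq_zero, ← h] at this

namespace TangentSetting

variable {X : P →ₗ[ℂ] E} {X' : R →ₗ[ℂ] E} {Y : Q →ₗ[ℂ] E} {G : P →ₗ[ℂ] Q}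

theorem inner_adjoint_adjoint (S : TangentSetting X X' Y G) (v v' : E) :
    inner ℂ (X'.adjoint v) (X'.adjoint v')
      = inner ℂ v v' - inner ℂ (X.adjoint v) (X.adjoint v') := by
  rw [LinearMap.adjoint_inner_left, LinearMap.adjoint_inner_left, eq_sub_iff_add_eq,
    ← inner_add_right, add_comm, S.add_eq]

theorem pinv_eq_zero (S : TangentSetting X X' Y G) {z : P}
    (hz : ∀ w, inner ℂ z (X.adjoint (Y w)) = 0) : G z = 0 := by
  have h : X.adjoint (Y (G z)) = 0 := by
    rw [← inner_self_eq_zero (𝕜 := ℂ), S.left_symmetric]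
    exact hz _
  rw [← S.self_mul_mul, h, map_zero]

/-- The error `d = G X† Y w - w` lies in the kernel of `X† Y`. If `Y` is an isometry, `hw` makes `w`
orthogonal to this kernel; since `G X† Y` is symmetric and kills `d`, also `⟨d, d⟩ = 0`. In the
other case `Y d = 0` at once, without `hw`. -/
theorem apply_pinv (S : TangentSetting X X' Y G) {w : Q}
    (hw : ∀ w', X.adjoint (Y w') = 0 → inner ℂ (Y w) (Y w') = 0) :
    Y (G (X.adjoint (Y w))) = Y w := by
  have hd : X.adjoint (Y (G (X.adjoint (Y w)) - w)) = 0 := by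
    rw [map_sub, map_sub, S.mul_mul_self, sub_self]
  rw [← sub_eq_zero, ← map_sub]
  rcases S.isometry_or_injOn with hY | hY
  · have h1 := hw _ hd
    rw [hY] at h1
    have h2 : G (X.adjoint (Y w)) - w = 0 := by
      rw [← inner_self_eq_zero (𝕜 := ℂ)]
      nth_rw 1 [inner_sub_left]
      rw [h1, S.right_symmetric, hd, map_zero, inner_zero_right, sub_zero]
    rw [h2, map_zero]
  · exact hY _ hd

variable {bx : OrthonormalBasis (Fin (finrank ℂ (LinearMap.range X))) ℂ (LinearMap.range X)}
  {by' : OrthonormalBasis (Fin (finrank ℂ (LinearMap.range Y))) ℂ (LinearMap.range Y)} {c : ℕ → ℂ}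

theorem tangent_eq_zero (S : TangentSetting X X' Y G)
    (D : DiagonalBases (LinearMap.range X) (LinearMap.range Y) bx by' c)
    {i : Fin (finrank ℂ (LinearMap.range X))} (hc : c i = 0) :
    X'.adjoint (Y (G (X.adjoint (bx i)))) = 0 := by
  rw [S.pinv_eq_zero, map_zero, map_zero]
  intro w
  obtain ⟨z, hz⟩ := (bx i).2
  rw [← hz, S.adjoint_apply_apply, LinearMap.adjoint_inner_right, hz, inner_eq_zero_symm]
  exact D.symm.mem_orthogonal_of_eq_zero (by simp [hc]) _ (LinearMap.mem_range_self _ _)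

/-- Since `by' j - c i • bx i` is orthogonal to the range of `X`, the vector `X† bx i` is `(c i)⁻¹ •
X† by' j`; writing `by' j = Y w`, the pseudoinverse followed by `Y` recovers `by' j`. -/
theorem tangent_eq_smul (S : TangentSetting X X' Y G)
    (D : DiagonalBases (LinearMap.range X) (LinearMap.range Y) bx by' c)
    {i : Fin (finrank ℂ (LinearMap.range X))} {j : Fin (finrank ℂ (LinearMap.range Y))}
    (h : i.1 = j.1) (hc : c i ≠ 0) :
    X'.adjoint (Y (G (X.adjoint (bx i)))) = (c i)⁻¹ • X'.adjoint (by' j) := by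
  obtain ⟨w, hw⟩ := (by' j).2
  have h1 : X.adjoint (bx i) = (c i)⁻¹ • X.adjoint (Y w) := by
    rw [hw, D.adjoint_eq_smul h, smul_smul, inv_mul_cancel₀ hc, one_smul]
  rw [h1, map_smul, map_smul, map_smul, S.apply_pinv, hw]
  intro w' hw'
  have h2 := D.inner_left h (LinearMap.mem_range_self Y w')
  obtain ⟨z, hz⟩ := (bx i).2
  rw [← hz, ← LinearMap.adjoint_inner_right, hw', inner_zero_right, ← h] at h2
  rw [hw]
  exact (mul_eq_zero.mp h2.symm).resolve_left hc

/-- Pythagoras for the complementary ranges: the part of the Gram matrix of `by'` seen by `X†` is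
`|c|²` on the diagonal, which leaves `1 - |c|²` for `X'†`. -/
theorem inner_adjoint_basis (S : TangentSetting X X' Y G)
    (D : DiagonalBases (LinearMap.range X) (LinearMap.range Y) bx by' c)
    {i i' : Fin (finrank ℂ (LinearMap.range X))} {j j' : Fin (finrank ℂ (LinearMap.range Y))}
    (h : i.1 = j.1) (h' : i'.1 = j'.1) :
    inner ℂ (X'.adjoint (by' j)) (X'.adjoint (by' j'))
      = if i = i' then 1 - ((‖c i‖ ^ 2 : ℝ) : ℂ) else 0 := by
  have hx : inner ℂ (X.adjoint (bx i)) (X.adjoint (bx i')) = if i = i' then (1 : ℂ) else 0 := by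
    obtain ⟨z, hz⟩ := (bx i').2
    rw [← hz, S.adjoint_apply_apply, LinearMap.adjoint_inner_left, hz]
    exact orthonormal_iff_ite.mp bx.orthonormal i i'
  have hy : inner ℂ (by' j : E) (by' j' : E) = if j = j' then (1 : ℂ) else 0 :=
    orthonormal_iff_ite.mp by'.orthonormal j j'
  have hij : j = j' ↔ i = i' := by
    rw [Fin.ext_iff, Fin.ext_iff, h, h']
  rw [S.inner_adjoint_adjoint, D.adjoint_eq_smul h, D.adjoint_eq_smul h', inner_smul_left,
    inner_smul_right, hx, hy]
  simp only [hij]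
  split_ifs with e
  · rw [← e, mul_one, RCLike.conj_mul]
    push_cast
    rfl
  · simp

/-- The singular values of the tangent map in terms of the cosines. -/
theorem map_singularValues (S : TangentSetting X X' Y G)
    (D : DiagonalBases (LinearMap.range X) (LinearMap.range Y) bx by' c) :
    (Multiset.range (finrank ℂ P)).map (X'.adjoint ∘ₗ Y ∘ₗ G).singularValues
      = (Multiset.range (finrank ℂ (LinearMap.range X))).map
          fun n => if c n = 0 then 0 else √(1 - ‖c n‖ ^ 2) / ‖c n‖ := by
  have hiso : ∀ z, ‖X z‖ = ‖z‖ := fun z => by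
    rw [@norm_eq_sqrt_re_inner ℂ, @norm_eq_sqrt_re_inner ℂ, ← LinearMap.adjoint_inner_right,
      S.adjoint_apply_apply]
  let e : P ≃ₗᵢ[ℂ] LinearMap.range X := LinearIsometry.equivRange ⟨X, hiso⟩
  have hb : ∀ i, (bx.map e.symm) i = X.adjoint (bx i) := fun i => by
    have h1 : X (e.symm (bx i)) = bx i := congrArg Subtype.val (e.apply_symm_apply (bx i))
    rw [OrthonormalBasis.map_apply, ← h1, S.adjoint_apply_apply]
  rw [LinearMap.map_singularValues_range_finrank _ (bx.map e.symm),
    ← Multiset.map_fin_univ_eq_map_range]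
  · refine Multiset.map_congr rfl fun i _ => ?_
    rw [hb, LinearMap.comp_apply, LinearMap.comp_apply]
    split_ifs with hc
    · rw [S.tangent_eq_zero D hc, norm_zero]
    · rw [S.tangent_eq_smul D (j := ⟨i, (D.lt_of_ne_zero hc).2⟩) rfl hc, norm_smul, norm_inv,
        @norm_eq_sqrt_re_inner ℂ _ _ _ _ (X'.adjoint _),
        S.inner_adjoint_basis D (i := i) (i' := i) rfl rfl, if_pos rfl]
      simp only [map_sub, RCLike.re_to_complex, Complex.ofReal_re, Complex.one_re]
      ring
  · intro i i' hne
    simp only [hb, LinearMap.comp_apply]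
    by_cases hc : c i = 0
    · rw [S.tangent_eq_zero D hc, inner_zero_left]
    by_cases hc' : c i' = 0
    · rw [S.tangent_eq_zero D hc', inner_zero_right]
    rw [S.tangent_eq_smul D (j := ⟨i, (D.lt_of_ne_zero hc).2⟩) rfl hc,
      S.tangent_eq_smul D (j := ⟨i', (D.lt_of_ne_zero hc').2⟩) rfl hc', inner_smul_left,
      inner_smul_right, S.inner_adjoint_basis D (i := i) (i' := i') rfl rfl, if_neg hne,
      mul_zero, mul_zero]

end TangentSetting

end TangentMap

/-! ### From multisets of cosines to sorted lists of tangents. -/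

section TangentList

theorem Fin.card_filter_univ_eq_card_filter_range (p : ℕ → Prop) [DecidablePred p] (n : ℕ) :
    (Finset.univ.filter fun j : Fin n => p j).card = ((Finset.range n).filter p).card := by
  rw [← Finset.card_map Fin.valEmbedding]
  congr 1
  ext i
  simp only [Finset.mem_map, Finset.mem_filter, Finset.mem_univ, true_and, Fin.valEmbedding_apply,
    Finset.mem_range]
  exact ⟨fun ⟨j, hj, e⟩ => e ▸ ⟨j.2, hj⟩, fun ⟨h, hp⟩ => ⟨⟨i, h⟩, hp, rfl⟩⟩

theorem Finset.filter_range_eq_of_forall_lt {p : ℕ → Prop} [DecidablePred p] {m n : ℕ}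
    (hmn : m ≤ n) (h : ∀ i, p i → i < m) :
    (Finset.range n).filter p = (Finset.range m).filter p := by
  ext i
  simp only [Finset.mem_filter, Finset.mem_range]
  exact ⟨fun hi => ⟨h i hi.2, hi.2⟩, fun hi => ⟨hi.1.trans_le hmn, hi.2⟩⟩

theorem Finset.card_filter_range_add_sub {p : ℕ → Prop} [DecidablePred p] {m n : ℕ}
    (hmn : m ≤ n) (h : ∀ i, ¬ p i → i < m) :
    ((Finset.range n).filter p).card = ((Finset.range m).filter p).card + (n - m) := by
  have h1 := Finset.card_filter_add_card_filter_not (s := Finset.range n) p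
  have h2 := Finset.card_filter_add_card_filter_not (s := Finset.range m) p
  rw [Finset.filter_range_eq_of_forall_lt hmn h] at h1
  simp only [Finset.card_range] at h1 h2
  omega

theorem Multiset.filter_add_filter_add_filter {α : Type*} (M : Multiset α) {p q r : α → Prop}
    [DecidablePred p] [DecidablePred q] [DecidablePred r] (hq : ∀ a ∈ M, q a → ¬ p a)
    (hr : ∀ a ∈ M, r a ↔ ¬ p a ∧ ¬ q a) :
    M.filter p + M.filter q + M.filter r = M := by
  have h1 : M.filter q = (M.filter fun a => ¬ p a).filter q := by
    rw [Multiset.filter_filter]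
    exact Multiset.filter_congr fun a ha => ⟨fun h => ⟨h, hq a ha h⟩, fun h => h.1⟩
  have h2 : M.filter r = (M.filter fun a => ¬ p a).filter fun a => ¬ q a := by
    rw [Multiset.filter_filter]
    exact Multiset.filter_congr fun a ha => (hr a ha).trans and_comm
  rw [h1, h2, add_assoc, Multiset.filter_add_not, Multiset.filter_add_not]

theorem extTan_monotoneOn : MonotoneOn extTan (Set.Icc 0 (Real.pi / 2)) := by
  intro s hs t ht hst
  unfold extTan
  split_ifs with h1 h2 h2
  · exact le_rfl
  · exact absurd (le_antisymm ht.2 (h1 ▸ hst)) h2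
  · exact le_top
  · have hs' := lt_of_le_of_ne hs.2 h1
    have ht' := lt_of_le_of_ne ht.2 h2
    have hpi := Real.pi_pos
    exact EReal.coe_le_coe_iff.mpr (Real.strictMonoOn_tan.monotoneOn
      ⟨by linarith [hs.1], hs'⟩ ⟨by linarith [ht.1], ht'⟩ hst)

theorem extTan_eq_of_mem_Icc {t : ℝ} (ht : t ∈ Set.Icc 0 (Real.pi / 2)) :
    extTan t = if Real.cos t = 0 then ⊤
      else ((√(1 - Real.cos t ^ 2) / Real.cos t : ℝ) : EReal) := by
  have hpi := Real.pi_pos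
  have hc : Real.cos t = 0 ↔ t = Real.pi / 2 := by
    refine ⟨fun h => ?_, fun h => by rw [h, Real.cos_pi_div_two]⟩
    by_contra hne
    exact (Real.cos_pos_of_mem_Ioo ⟨by linarith [ht.1], lt_of_le_of_ne ht.2 hne⟩).ne' h
  rw [extTan, Real.tan_eq_sin_div_cos, ← Real.sin_eq_sqrt_one_sub_cos_sq ht.1 (by linarith [ht.2])]
  simp only [hc]

theorem tanVector_pairwise {m : ℕ} {θ : Fin m → ℝ} (hθ : Monotone θ)
    (hI : ∀ k, θ k ∈ Set.Icc 0 (Real.pi / 2)) : (tanVector θ).Pairwise (· ≥ ·) := by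
  rw [tanVector, List.pairwise_reverse, List.pairwise_map, List.pairwise_ofFn]
  exact fun i j hij => extTan_monotoneOn (hI i) (hI j) (hθ hij.le)

theorem posSingularValues_pairwise {n k : ℕ} (A : Matrix (Fin n) (Fin k) ℂ) :
    (posSingularValues A).Pairwise (· ≥ ·) := by
  refine List.Pairwise.filter _ ?_
  rw [List.pairwise_map]
  exact List.pairwise_lt_range.imp fun h => LinearMap.singularValues_antitone _ h.le

theorem posSingularValues_pos {n k : ℕ} (A : Matrix (Fin n) (Fin k) ℂ) {s : ℝ}
    (hs : s ∈ posSingularValues A) : 0 < s := by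
  simpa using (List.mem_filter.mp hs).2

theorem coe_posSingularValues {n k : ℕ} (A : Matrix (Fin n) (Fin k) ℂ) :
    (posSingularValues A : Multiset ℝ)
      = ((Multiset.range k).map (toEuclideanLin A).singularValues).filter (0 < ·) := rfl

theorem replicate_append_pairwise {l : List ℝ} (hl : l.Pairwise (· ≥ ·)) (hpos : ∀ s ∈ l, 0 < s)
    (a b : ℕ) : (List.replicate a (⊤ : EReal) ++ l.map Real.toEReal ++
      List.replicate b (0 : EReal)).Pairwise (· ≥ ·) := by
  rw [List.pairwise_append, List.pairwise_append]
  refine ⟨⟨?_, ?_, ?_⟩, ?_, ?_⟩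
  · exact List.pairwise_replicate.mpr (Or.inr le_rfl)
  · rw [List.pairwise_map]
    exact hl.imp fun h => EReal.coe_le_coe_iff.mpr h
  · intro s hs t _
    rw [List.eq_of_mem_replicate hs]
    exact le_top
  · exact List.pairwise_replicate.mpr (Or.inr le_rfl)
  · intro s hs t ht
    rw [List.eq_of_mem_replicate ht]
    rcases List.mem_append.mp hs with hs | hs
    · rw [List.eq_of_mem_replicate hs]
      exact le_top
    · obtain ⟨u, hu, rfl⟩ := List.mem_map.mp hs
      exact EReal.coe_nonneg.mpr (hpos u hu).le

/-- The list of tangents is determined by the cosines `‖c k‖`. -/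
theorem tanVector_eq {a b : ℕ} {θ : Fin (min a b) → ℝ} (hθ : Monotone θ)
    (hI : ∀ k, θ k ∈ Set.Icc 0 (Real.pi / 2)) {c : ℕ → ℂ} (hc : ∀ k, Real.cos (θ k) = ‖c k‖)
    (hc0 : ∀ i, min a b ≤ i → c i = 0) {l : List ℝ} (hl : l.Pairwise (· ≥ ·))
    (hpos : ∀ s ∈ l, 0 < s)
    (hlc : (l : Multiset ℝ) = ((Multiset.range a).map
      fun n => if c n = 0 then 0 else √(1 - ‖c n‖ ^ 2) / ‖c n‖).filter (0 < ·)) :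
    tanVector θ =
      List.replicate (min (Finset.univ.filter fun j : Fin b => c j = 0).card
        (Finset.univ.filter fun j : Fin a => c j = 0).card) ⊤ ++ l.map Real.toEReal ++
      List.replicate (Finset.univ.filter fun j : Fin b => ‖c j‖ = 1).card 0 := by
  refine List.Perm.eq_of_pairwise' (tanVector_pairwise hθ hI)
    (replicate_append_pairwise hl hpos _ _) (Multiset.coe_eq_coe.mp ?_)
  have hlt : ∀ i, c i ≠ 0 → i < min a b := fun i hi => by
    by_contra h
    exact hi (hc0 i (not_lt.mp h))
  have hle : ∀ i, ‖c i‖ ≤ 1 := fun i => by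
    by_cases h : c i = 0
    · simp [h]
    · exact (hc ⟨i, hlt i h⟩).symm.trans_le (Real.cos_le_one _)
  -- Where `c n = 0` the singular value is `0` but the tangent is `∞`; these indices drop out of the
  -- positive singular values and are counted separately.
  set τ : ℕ → ℝ := fun n => if c n = 0 then 0 else √(1 - ‖c n‖ ^ 2) / ‖c n‖ with hτ
  have hτpos : ∀ i, 0 < τ i ↔ c i ≠ 0 ∧ ‖c i‖ ≠ 1 := fun i => by
    simp only [hτ]
    split_ifs with h
    · simp [h]
    · have hn : 0 < ‖c i‖ := norm_pos_iff.mpr h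
      rw [div_pos_iff_of_pos_right hn, Real.sqrt_pos, sub_pos, sq_lt_one_iff₀ hn.le]
      exact ⟨fun h1 => ⟨h, h1.ne⟩, fun h1 => lt_of_le_of_ne (hle i) h1.2⟩
  have hτ0 : ∀ i, ‖c i‖ = 1 → τ i = 0 := fun i h => by
    simp [hτ, h]
  have hlc' : (l : Multiset ℝ) = ((Multiset.range (min a b)).filter fun i => 0 < τ i).map τ := by
    rw [hlc, Multiset.filter_map]
    exact congrArg (Multiset.map τ) (congrArg Finset.val (Finset.filter_range_eq_of_forall_lt
      (p := fun i => 0 < τ i) (min_le_left a b) fun i hi => hlt i ((hτpos i).mp hi).1))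
  -- Beyond `min a b` every `c` vanishes, adding `b - min a b` and `a - min a b` to the two counts.
  -- One of these surpluses is zero, so the minimum counts exactly the right angles.
  have hinf : min (Finset.univ.filter fun j : Fin b => c j = 0).card
      (Finset.univ.filter fun j : Fin a => c j = 0).card
        = ((Finset.range (min a b)).filter fun i => c i = 0).card := by
    rw [Fin.card_filter_univ_eq_card_filter_range (fun i => c i = 0),
      Fin.card_filter_univ_eq_card_filter_range (fun i => c i = 0),
      Finset.card_filter_range_add_sub (min_le_left a b) hlt,
      Finset.card_filter_range_add_sub (min_le_right a b) hlt]
    omega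
  have hone : (Finset.univ.filter fun j : Fin b => ‖c j‖ = 1).card
      = ((Finset.range (min a b)).filter fun i => ‖c i‖ = 1).card := by
    rw [Fin.card_filter_univ_eq_card_filter_range (fun i => ‖c i‖ = 1),
      Finset.filter_range_eq_of_forall_lt (min_le_right a b)]
    exact fun i hi => hlt i fun h => by simp [h] at hi
  rw [hinf, hone, ← Multiset.coe_add, ← Multiset.coe_add, ← Multiset.map_coe, hlc',
    Multiset.coe_replicate, Multiset.coe_replicate, tanVector, Multiset.coe_reverse,
    ← Multiset.map_coe, ← Fin.univ_val_map, Multiset.map_map, Multiset.map_map]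
  set g : ℕ → EReal := fun i => if c i = 0 then ⊤ else (τ i : EReal) with hg
  have hgθ : (Finset.univ : Finset (Fin (min a b))).val.map (extTan ∘ θ)
      = (Multiset.range (min a b)).map g := by
    rw [← Multiset.map_fin_univ_eq_map_range]
    refine Multiset.map_congr rfl fun k _ => ?_
    rw [Function.comp_apply, extTan_eq_of_mem_Icc (hI k), hc k, hg]
    simp only [norm_eq_zero, hτ]
    split_ifs <;> rfl
  rw [hgθ]
  -- The indices split into right angles, angles strictly between, and zero angles, matching the
  -- three blocks of the list.
  conv_lhs =>
    rw [← (Multiset.range (min a b)).filter_add_filter_add_filter (p := fun i => c i = 0)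
      (q := fun i => 0 < τ i) (r := fun i => ‖c i‖ = 1) (fun i _ hi => ((hτpos i).mp hi).1)
      (fun i _ => by
        rw [hτpos]
        by_cases h : c i = 0
        · simp [h]
        · simp [h])]
  rw [Multiset.map_add, Multiset.map_add]
  congr 1
  · congr 1
    · refine Multiset.eq_replicate.mpr ⟨by rw [Multiset.card_map]; rfl, fun s hs => ?_⟩
      obtain ⟨i, hi, rfl⟩ := Multiset.mem_map.mp hs
      exact if_pos (Multiset.mem_filter.mp hi).2
    · refine Multiset.map_congr rfl fun i hi => ?_
      exact if_neg ((hτpos i).mp (Multiset.mem_filter.mp hi).2).1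
  · refine Multiset.eq_replicate.mpr ⟨by rw [Multiset.card_map]; rfl, fun s hs => ?_⟩
    obtain ⟨i, hi, rfl⟩ := Multiset.mem_map.mp hs
    have h1 := (Multiset.mem_filter.mp hi).2
    have h0 : c i ≠ 0 := fun h => by simp [h] at h1
    simp only [hg, if_neg h0, hτ0 i h1, EReal.coe_zero]

end TangentList

/-! ### Translation from matrices to linear maps. -/

section Matrices

open Module

theorem Matrix.rank_eq_finrank_colRange {n k : ℕ} (A : Matrix (Fin n) (Fin k) ℂ) :
    A.rank = finrank ℂ (colRange A) := by
  rw [colRange, A.rank_eq_finrank_range_toLin (PiLp.basisFun 2 ℂ (Fin n))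
    (PiLp.basisFun 2 ℂ (Fin k)), toEuclideanLin, toLpLin_eq_toLin]

/-- A linear map which preserves the dimension of the range of another one is injective there. -/
theorem LinearMap.apply_eq_zero_of_finrank_range_eq {K U V W : Type*} [Field K]
    [AddCommGroup U] [Module K U] [AddCommGroup V] [Module K V] [FiniteDimensional K V]
    [AddCommGroup W] [Module K W] (f : V →ₗ[K] W) (g : U →ₗ[K] V)
    (h : finrank K (LinearMap.range g) = finrank K (LinearMap.range (f ∘ₗ g))) {u : U}
    (hu : f (g u) = 0) : g u = 0 := by
  have h1 := LinearMap.finrank_range_add_finrank_ker (f.domRestrict (LinearMap.range g))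
  rw [LinearMap.range_domRestrict, ← LinearMap.range_comp, h] at h1
  have h2 : LinearMap.ker (f.domRestrict (LinearMap.range g)) = ⊥ := by
    rw [← Submodule.finrank_eq_zero (R := K)]
    omega
  have h3 : (⟨g u, LinearMap.mem_range_self g u⟩ : LinearMap.range g) = 0 :=
    LinearMap.ker_eq_bot'.mp h2 _ hu
  exact congrArg Subtype.val h3

theorem Matrix.adjoint_toEuclideanLin {n p q : ℕ} (X : Matrix (Fin n) (Fin p) ℂ)
    (Y : Matrix (Fin n) (Fin q) ℂ) :
    toEuclideanLin (Xᴴ * Y) = (toEuclideanLin X).adjoint ∘ₗ toEuclideanLin Y := by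
  rw [← toEuclideanLin_conjTranspose_eq_adjoint]
  exact toLpLin_mul 2 2 2 _ _

/-- The rank hypothesis is used only in this form: `X†` is injective on the range of `Y`. -/
theorem eq_zero_of_rank_eq {n p q : ℕ} {X : Matrix (Fin n) (Fin p) ℂ}
    {Y : Matrix (Fin n) (Fin q) ℂ} (h : Y.rank = (Xᴴ * Y).rank) (w : EuclideanSpace ℂ (Fin q))
    (hw : (toEuclideanLin X).adjoint (toEuclideanLin Y w) = 0) : toEuclideanLin Y w = 0 := by
  rw [rank_eq_finrank_colRange, rank_eq_finrank_colRange, colRange, colRange,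
    adjoint_toEuclideanLin] at h
  exact LinearMap.apply_eq_zero_of_finrank_range_eq _ _ h hw

theorem inner_toEuclideanLin_of_isHermitian {k : ℕ} {A : Matrix (Fin k) (Fin k) ℂ} (h : Aᴴ = A)
    (v w : EuclideanSpace ℂ (Fin k)) :
    inner ℂ (toEuclideanLin A v) w = inner ℂ v (toEuclideanLin A w) := by
  rw [← LinearMap.adjoint_inner_left, ← toEuclideanLin_conjTranspose_eq_adjoint, h]

theorem tangentSetting_of_fromCols {n p r q : ℕ}
    {X : Matrix (Fin n) (Fin p) ℂ} {Xperp : Matrix (Fin n) (Fin r) ℂ}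
    (hU₁ : (fromCols X Xperp)ᴴ * fromCols X Xperp = 1)
    (hU₂ : fromCols X Xperp * (fromCols X Xperp)ᴴ = 1)
    {Y : Matrix (Fin n) (Fin q) ℂ} (hY : Yᴴ * Y = 1 ∨ Y.rank = (Xᴴ * Y).rank) :
    TangentSetting (toEuclideanLin X) (toEuclideanLin Xperp) (toEuclideanLin Y)
      (toEuclideanLin (pinv (Xᴴ * Y))) := by
  rw [conjTranspose_fromCols_eq_fromRows_conjTranspose] at hU₁ hU₂
  rw [fromRows_mul_fromCols, ← fromBlocks_one, fromBlocks_inj] at hU₁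
  rw [fromCols_mul_fromRows] at hU₂
  have hmul : ∀ {a b d : ℕ} (A : Matrix (Fin a) (Fin b) ℂ) (B : Matrix (Fin b) (Fin d) ℂ) v,
      toEuclideanLin A (toEuclideanLin B v) = toEuclideanLin (A * B) v := fun A B v => by
    rw [toEuclideanLin, toLpLin_mul 2 2 2 A B]
    rfl
  have hone : ∀ {a : ℕ} (v : EuclideanSpace ℂ (Fin a)),
      toEuclideanLin (1 : Matrix (Fin a) (Fin a) ℂ) v = v := fun v => by
    rw [toEuclideanLin, toLpLin_one]
    rfl
  have hC := pinv_isMoorePenrose (Xᴴ * Y)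
  constructor
  · intro z
    rw [← toEuclideanLin_conjTranspose_eq_adjoint, hmul, hU₁.1, hone]
  · intro v
    rw [← toEuclideanLin_conjTranspose_eq_adjoint, ← toEuclideanLin_conjTranspose_eq_adjoint,
      hmul, hmul, ← LinearMap.add_apply, ← map_add, hU₂, hone]
  · intro w
    simp only [← toEuclideanLin_conjTranspose_eq_adjoint, hmul]
    rw [← Matrix.mul_assoc Xᴴ, ← Matrix.mul_assoc, hC.mul_mul_self]
  · intro z
    simp only [← toEuclideanLin_conjTranspose_eq_adjoint, hmul]
    rw [← Matrix.mul_assoc Xᴴ, ← Matrix.mul_assoc, hC.self_mul_mul]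
  · intro z z'
    simp only [← toEuclideanLin_conjTranspose_eq_adjoint, hmul]
    rw [← Matrix.mul_assoc Xᴴ]
    exact inner_toEuclideanLin_of_isHermitian hC.left_hermitian z z'
  · intro w w'
    simp only [← toEuclideanLin_conjTranspose_eq_adjoint, hmul]
    exact inner_toEuclideanLin_of_isHermitian hC.right_hermitian w w'
  · refine hY.imp (fun h w w' => ?_) fun h => eq_zero_of_rank_eq h
    rw [← LinearMap.adjoint_inner_right, ← toEuclideanLin_conjTranspose_eq_adjoint, hmul, h, hone]

end Matrices

theorem theorem3p1 {n p r q : ℕ}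
    (X : Matrix (Fin n) (Fin p) ℂ) (Xperp : Matrix (Fin n) (Fin r) ℂ)
    (hU₁ : (fromCols X Xperp)ᴴ * fromCols X Xperp = 1)
    (hU₂ : fromCols X Xperp * (fromCols X Xperp)ᴴ = 1)
    (Y : Matrix (Fin n) (Fin q) ℂ)
    (hY : Yᴴ * Y = 1 ∨ Y.rank = (Xᴴ * Y).rank) :
    (∃ θ, IsPrincipalAngles (colRange X) (colRange Y) θ) ∧
    (∀ θ, IsPrincipalAngles (colRange X) (colRange Y) θ →
      tanVector θ =
        List.replicate
          (min (Module.finrank ℂ ↥((colRange X)ᗮ ⊓ colRange Y))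
            (Module.finrank ℂ ↥(colRange X ⊓ (colRange Y)ᗮ))) ⊤ ++
        (posSingularValues (Xperpᴴ * Y * pinv (Xᴴ * Y))).map Real.toEReal ++
        List.replicate (Module.finrank ℂ ↥(colRange X ⊓ colRange Y)) 0) ∧
    (Y.rank = (Xᴴ * Y).rank →
      min (Module.finrank ℂ ↥((colRange X)ᗮ ⊓ colRange Y))
        (Module.finrank ℂ ↥(colRange X ⊓ (colRange Y)ᗮ)) = 0) := by
  refine ⟨?_, fun θ hθ => ?_, fun h => ?_⟩
  · obtain ⟨x, y, θ, h⟩ := exists_isPrincipalSystem (𝒳 := colRange X) (𝒴 := colRange Y)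
      (min_le_left _ _) (min_le_right _ _)
    exact ⟨θ, x, y, h⟩
  · obtain ⟨x, y, hxy⟩ := hθ
    have hP : IsPrincipalSystem (colRange X) (colRange Y) x y θ := hxy
    obtain ⟨bx, b, c, D, hc⟩ := hP.exists_diagonalBases
    have hS := tangentSetting_of_fromCols hU₁ hU₂ hY
    have hT : toEuclideanLin (Xperpᴴ * Y * pinv (Xᴴ * Y)) = (toEuclideanLin Xperp).adjoint ∘ₗ
        toEuclideanLin Y ∘ₗ toEuclideanLin (pinv (Xᴴ * Y)) := by
      rw [← LinearMap.comp_assoc, ← adjoint_toEuclideanLin]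
      exact toLpLin_mul 2 2 2 _ _
    -- Exchanging the subspaces conjugates `c`, which does not move its zeros; this counts the
    -- dimension of the other intersection.
    have hinf := D.symm.finrank_orthogonal_inf
    simp only [star_eq_zero] at hinf
    rw [D.finrank_orthogonal_inf, inf_comm (colRange X) (colRange Y)ᗮ, hinf, D.finrank_inf]
    refine tanVector_eq hP.monotone (fun k => (hP k).1) hc D.eq_zero
      (posSingularValues_pairwise _) (fun s hs => posSingularValues_pos _ hs) ?_
    have hsv := hS.map_singularValues D
    rw [finrank_euclideanSpace_fin] at hsv
    rw [coe_posSingularValues, hT, hsv]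
    rfl
  · have : (colRange X)ᗮ ⊓ colRange Y = ⊥ := by
      rw [Submodule.eq_bot_iff]
      rintro v ⟨hv, w, rfl⟩
      exact eq_zero_of_rank_eq h w (LinearMap.adjoint_eq_zero_of_mem_range_orthogonal _ hv)
    rw [this, finrank_bot, Nat.zero_min]
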